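/- Let $\alpha>0$ and $0<\nu\le 1$. On $[0,1]$ use the weighted inner product $\langle u,v\rangle=\int_0^1 u(x)v(x)x^{\nu-1}\,dx$ and norm $\|u\|_2=\langle u,u\rangle^{1/2}$. For $0\le n\le N$ let $$\widetilde C_{N,n,\nu}(x)=\sum_{j=n}^{N}(-1)^{j-n}\binom{N-n}{j-n}\binom{N+j+1}{N-n}x^{j\nu}$$ be the fractional Chelyshkov polynomials and let $\Phi=[\widetilde C_{N,0,\nu},\dots,\widetilde C_{N,N,\nu}]^T$. For $0\le k,j\le N$ put $\xi_{k,j}=\nu(2k+1)\langle x^{j\nu+\alpha},\widetilde C_{N,k,\nu}\rangle$ (the coefficients of the best approximation of $x^{j\nu+\alpha}$ in the span of the $\widetilde C_{N,k,\nu}$), and let $\mathcal P=(\Theta(n,k))_{n,k=0}^{N}$ be the fractional operational matrix of integration, $$\Theta(n,k)=\sum_{j=n}^{N}(-1)^{j-n}\binom{N-n}{j-n}\binom{N+j+1}{N-n}B(\alpha,j\nu+1)\,\xi_{k,j},$$ where $B$ is the Beta function. Let $$\mathcal E(x)=[e_0(x),\dots,e_N(x)]^T=\int_0^x (x-s)^{\alpha-1}\Phi(s)\,ds-\mathcal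 P\,\Phi(x)$$ be the error vector; its components depend on $N$. For functions $\phi_1,\dots,\phi_m$ let $\Psi(\phi_1,\dots,\phi_m)=\det(\langle\phi_i,\phi_j\rangle)_{i,j}$ be their Gram determinant. Then: 1. for all $N$ and $0\le n\le N$, $e_n$ belongs to the weighted space $L^2([0,1],x^{\nu-1}dx)$; 2. for all $N$, $\Psi(\widetilde C_{N,0,\nu},\dots,\widetilde C_{N,N,\nu})>0$, and for $0\le j\le N$ $$\Big\|x^{j\nu+\alpha}-\sum_{k=0}^{N}\xi_{k,j}\widetilde C_{N,k,\nu}\Big\|_2^2=\frac{\Psi(x^{j\nu+\alpha},\widetilde C_{N,0,\nu},\dots,\widetilde C_{N,N,\nu})}{\Psi(\widetilde C_{N,0,\nu},\dots,\widetilde C_{N,N,\nu})};$$ 3. for all $N$ and $0\le n\le N$, $$\|e_n\|_2\le\sum_{j=n}^{N}\binom{N-n}{j-n}\binom{N+j+1}{N-n}B(\alpha,j\nu+1)\left(\frac{\Psi(x^{j\nu+\alpha},\widetilde C_{N,0,\nu},\dots,\widetilde C_{N,N,\nu})}{\Psi(\widetilde C_{N,0,\nu},\dots,\widetilde C_{N,N,\nu})}\right)^{1/2};$$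 4. $\|e_n\|_2\to 0$ as $N\to\infty$, uniformly in $n$: $\max_{0\le n\le N}\|e_n\|_2\to0$; in particular this holds for each fixed $n$. -/

import Mathlib

noncomputable section

namespace FracChelyshkov

/-- The weighted inner product `⟨u, v⟩ = ∫₀¹ u(x) v(x) x^(ν-1) dx`. -/
def wInner (ν : ℝ) (u v : ℝ → ℝ) : ℝ :=
  ∫ x in (0 : ℝ)..1, u x * v x * x ^ (ν - 1)

/-- The weighted norm `‖u‖₂ = ⟨u, u⟩^(1/2)`. -/
def wNorm (ν : ℝ) (u : ℝ → ℝ) : ℝ :=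
  Real.sqrt (wInner ν u u)

/-- Membership in the weighted space `L²` over `[0, 1]` with weight `x^(ν-1)`. -/
def MemWL2 (ν : ℝ) (u : ℝ → ℝ) : Prop :=
  MeasureTheory.AEStronglyMeasurable u (MeasureTheory.volume.restrict (Set.Icc (0 : ℝ) 1)) ∧
    MeasureTheory.IntegrableOn (fun x : ℝ => u x ^ 2 * x ^ (ν - 1)) (Set.Icc (0 : ℝ) 1)

/-- The fractional Chelyshkov polynomial of index `n ≤ N`,
`∑_{j=n}^{N} (-1)^(j-n) C(N-n, j-n) C(N+j+1, N-n) x^(jν)`. -/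
def chelyshkov (ν : ℝ) (N n : ℕ) (x : ℝ) : ℝ :=
  ∑ j ∈ Finset.Icc n N, (-1 : ℝ) ^ (j - n) * ((N - n).choose (j - n) : ℝ) *
    ((N + j + 1).choose (N - n) : ℝ) * x ^ ((j : ℝ) * ν)

/-- The vector `Φ(x)` of the fractional Chelyshkov polynomials of indices `0, …, N`. -/
def Phi (ν : ℝ) (N : ℕ) (x : ℝ) : Fin (N + 1) → ℝ :=
  fun n => chelyshkov ν N n x

/-- The monomial `x^(jν+α)`. -/
def fracMonomial (α ν : ℝ) (j : ℕ) (x : ℝ) : ℝ :=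
  x ^ ((j : ℝ) * ν + α)

/-- The coefficient of the best approximation of `x^(jν+α)` along the polynomial of index `k`. -/
def xi (α ν : ℝ) (N k j : ℕ) : ℝ :=
  ν * (2 * (k : ℝ) + 1) * wInner ν (fracMonomial α ν j) (chelyshkov ν N k)

/-- The Beta function is `ProbabilityTheory.beta a b = Γ(a) Γ(b) / Γ(a + b)`. -/
def Theta (α ν : ℝ) (N n k : ℕ) : ℝ :=
  ∑ j ∈ Finset.Icc n N, (-1 : ℝ) ^ (j - n) * ((N - n).choose (j - n) : ℝ) *
    ((N + j + 1).choose (N - n) : ℝ) * ProbabilityTheory.beta α ((j : ℝ) * ν + 1) * xi α ν N k j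

/-- The fractional operational matrix of integration. -/
def opMatrix (α ν : ℝ) (N : ℕ) : Matrix (Fin (N + 1)) (Fin (N + 1)) ℝ :=
  Matrix.of fun n k => Theta α ν N n k

/-- The `n`-th component `e_n` of the error vector
`∫₀ˣ (x-s)^(α-1) Φ(s) ds - 𝒫 Φ(x)`, as a function of `x`. -/
def errorVec (α ν : ℝ) (N : ℕ) (n : Fin (N + 1)) (x : ℝ) : ℝ :=
  (∫ s in (0 : ℝ)..x, (x - s) ^ (α - 1) * Phi ν N s n) -
    (opMatrix α ν N).mulVec (Phi ν N x) n

/-- The error of the best approximation of `x^(jν+α)` by `∑ₖ ξ_{k,j} C_{N,k}`. -/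
def monomialError (α ν : ℝ) (N j : ℕ) (x : ℝ) : ℝ :=
  fracMonomial α ν j x - ∑ k : Fin (N + 1), xi α ν N k j * Phi ν N x k

/-- The Gram determinant of finitely many functions for the weighted inner product. -/
def gramDet (ν : ℝ) {m : ℕ} (φ : Fin m → ℝ → ℝ) : ℝ :=
  (Matrix.of fun i j => wInner ν (φ i) (φ j)).det

/-- The quotient of Gram determinants
`Ψ(u, C_{N,0}, …, C_{N,N}) / Ψ(C_{N,0}, …, C_{N,N})`. -/
def gramRatio (ν : ℝ) (N : ℕ) (u : ℝ → ℝ) : ℝ :=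
  gramDet ν (Matrix.vecCons u fun k : Fin (N + 1) => chelyshkov ν N k) /
    gramDet ν (fun k : Fin (N + 1) => chelyshkov ν N k)

end FracChelyshkov

end

/-! With `t = x^ν`, the inner product of `x^(mν)` with `chelyshkov ν N n` is `ν⁻¹` times a finite
difference of a rational function with one simple pole. It vanishes for `n < m ≤ N`, which makes the
polynomials orthogonal with squared norms `1/(ν(2n+1))`. Hence `∑ₖ ξ_{k,j} C_{N,k}` is the
orthogonal projection of `x^(jν+α)`.

The fractional integral of a power is a Beta value times a power, so on `(0, 1]` each `e_n` is a
finite combination of the continuous functions `monomialError` (`errorVec_eq_errorSum`). Membership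
in the weighted space follows. A row operation on the Gram matrix gives the quotient of determinants
(`gramDet_vecCons`), and the triangle inequality gives the bound on the norm.

Convergence does not use that bound. The function `e_n` is the fractional integral of `C_{N,n}`
minus its projection onto the span of the `x^(mν)`, `m ≤ N`, so its norm is at most the distance to
any element of that span (`wInner_errorSum_le`). The `C_{N,n}` lie in the ball of radius `ν^(-1/2)`,
and fractional integration is compact: `exists_uniform_approx` gives one degree `m` that serves the
whole ball, hence uniformity in `n`. For this the kernel `y^(α-1)` is split into a part of small
`L¹` norm, controlled by Young's inequality, and a continuous part, approximated by Bernstein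
polynomials in `x^ν`. -/

namespace FracChelyshkov

/-! ### Finite differences and the coefficients of the Chelyshkov polynomials. -/

section Algebra

open Finset

/-- Partial fractions: `∑ (-1)^i C(d,i) / (a+i) = d! / (a (a+1) ⋯ (a+d))`. -/
theorem sum_neg_one_pow_choose_div (d : ℕ) : ∀ a : ℝ, 0 < a →
    ∑ i ∈ range (d + 1), (-1 : ℝ) ^ i * (d.choose i : ℝ) / (a + i) =
      (d.factorial : ℝ) / ∏ i ∈ range (d + 1), (a + i) := by
  induction d with
  | zero => intro a _; simp
  | succ d ih =>
    intro a ha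
    have h1 := ih a ha
    have h2 := ih (a + 1) (by linarith)
    -- Pascal's rule; the sum at `a` can be extended by one term because `d.choose (d + 1) = 0`.
    have hsplit : ∑ i ∈ range (d + 1 + 1), (-1 : ℝ) ^ i * ((d + 1).choose i : ℝ) / (a + i) =
        ∑ i ∈ range (d + 1), (-1 : ℝ) ^ i * (d.choose i : ℝ) / (a + i) -
          ∑ i ∈ range (d + 1), (-1 : ℝ) ^ i * (d.choose i : ℝ) / (a + 1 + i) := by
      have h0 : ∑ i ∈ range (d + 1), (-1 : ℝ) ^ i * (d.choose i : ℝ) / (a + i) =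
          ∑ i ∈ range (d + 1 + 1), (-1 : ℝ) ^ i * (d.choose i : ℝ) / (a + i) := by
        rw [sum_range_succ _ (d + 1)]
        simp
      rw [h0, sum_range_succ' _ (d + 1), sum_range_succ' _ (d + 1), add_sub_right_comm,
        ← sum_sub_distrib]
      congr 1
      · refine sum_congr rfl fun i _ => ?_
        rw [Nat.choose_succ_succ]
        push_cast
        rw [show a + ((i : ℝ) + 1) = a + 1 + i by ring]
        ring
      · simp
    rw [hsplit, h1, h2]
    have hP : ∀ i : ℕ, (0 : ℝ) < a + 1 + i := fun i => by positivity
    have e1 : ∏ i ∈ range (d + 1 + 1), (a + (i : ℝ)) = a * ∏ i ∈ range (d + 1), (a + 1 + i) := by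
      rw [prod_range_succ' _ (d + 1)]
      push_cast
      rw [mul_comm]
      simp only [add_zero]
      congr 1
      exact prod_congr rfl fun i _ => by ring
    have e2 : (∏ i ∈ range (d + 1), (a + (i : ℝ))) * (a + 1 + d) =
        a * ∏ i ∈ range (d + 1), (a + 1 + i) := by
      rw [← e1, prod_range_succ _ (d + 1)]
      push_cast
      ring
    have p1 : (0 : ℝ) < ∏ i ∈ range (d + 1), (a + (i : ℝ)) := prod_pos fun i _ => by positivity
    have p2 : (0 : ℝ) < ∏ i ∈ range (d + 1), (a + 1 + (i : ℝ)) := prod_pos fun i _ => hP i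
    rw [e1, Nat.factorial_succ]
    push_cast
    set A := ∏ i ∈ range (d + 1), (a + (i : ℝ))
    set B := ∏ i ∈ range (d + 1), (a + 1 + (i : ℝ))
    have hd := hP d
    have hA : A = a * B / (a + 1 + d) := by rw [← e2]; field_simp
    rw [hA]
    field_simp
    ring

/-- Finite differences of order `d` annihilate polynomials of degree less than `d`. -/
theorem sum_neg_one_pow_choose_eval_eq_zero {d : ℕ} {P : Polynomial ℝ} (hP : P.natDegree < d) :
    ∑ i ∈ range (d + 1), (-1 : ℝ) ^ i * (d.choose i : ℝ) * P.eval (i : ℝ) = 0 := by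
  have h := congrFun (Polynomial.fwdDiff_iter_eq_zero_of_degree_lt hP) 0
  rw [fwdDiff_iter_eq_sum_shift] at h
  have h2 : (-1 : ℝ) ^ d * ∑ i ∈ range (d + 1), (-1 : ℝ) ^ i * (d.choose i : ℝ) * P.eval (i : ℝ)
      = 0 := by
    rw [mul_sum, ← Pi.zero_apply (M := fun _ : ℝ => ℝ) 0, ← h]
    refine sum_congr rfl fun i hi => ?_
    have hi' : i ≤ d := by simpa [Nat.lt_succ_iff] using hi
    have : (-1 : ℝ) ^ d * (-1) ^ i = (-1) ^ (d - i) := by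
      obtain ⟨k, rfl⟩ := Nat.exists_eq_add_of_le hi'
      rw [Nat.add_sub_cancel_left, pow_add, mul_right_comm, ← mul_pow]
      simp
    simp only [zero_add, nsmul_eq_mul, mul_one, zsmul_eq_mul]
    push_cast
    rw [← this]
    ring
  simpa using h2

/-- Only the residue of `P(y)/(y+a)` contributes to its finite difference of order `deg P`. -/
theorem sum_neg_one_pow_choose_eval_div {d : ℕ} {P : Polynomial ℝ} (hP : P.natDegree ≤ d)
    {a : ℝ} (ha : 0 < a) :
    ∑ i ∈ range (d + 1), (-1 : ℝ) ^ i * (d.choose i : ℝ) * P.eval (i : ℝ) / (a + i) =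
      P.eval (-a) * ((d.factorial : ℝ) / ∏ i ∈ range (d + 1), (a + i)) := by
  rw [← sum_neg_one_pow_choose_div d a ha]
  -- Division by `y + a` leaves the constant `P(-a)` over the pole and a quotient `Q` of degree
  -- below `d`, which the difference annihilates.
  obtain ⟨Q, hQ⟩ : (Polynomial.X - Polynomial.C (-a)) ∣ P - Polynomial.C (P.eval (-a)) :=
    Polynomial.X_sub_C_dvd_sub_C_eval
  have hev : ∀ y : ℝ, P.eval y = P.eval (-a) + (a + y) * Q.eval y := fun y => by
    have := congrArg (Polynomial.eval y) hQ
    simp at this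
    linarith
  have hterm : ∀ i : ℕ, (-1 : ℝ) ^ i * (d.choose i : ℝ) * P.eval (i : ℝ) / (a + i) =
      P.eval (-a) * ((-1 : ℝ) ^ i * (d.choose i : ℝ) / (a + i)) +
        (-1 : ℝ) ^ i * (d.choose i : ℝ) * Q.eval (i : ℝ) := fun i => by
    have : (0 : ℝ) < a + i := by positivity
    rw [hev i]
    field_simp
  simp only [hterm, sum_add_distrib, ← mul_sum]
  rw [add_eq_left]
  -- For `d = 0` no degree is strictly below `d`, but then `P` is constant and `Q` vanishes at `0`.
  rcases Nat.eq_zero_or_pos d with rfl | hd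
  · have hc : P = Polynomial.C (P.coeff 0) := Polynomial.eq_C_of_natDegree_le_zero hP
    have h0 := hev 0
    rw [hc] at h0
    simp at h0
    simpa [ha.ne'] using h0
  · apply sum_neg_one_pow_choose_eval_eq_zero
    by_cases hQ0 : Q = 0
    · simpa [hQ0] using hd
    have h1 : (P - Polynomial.C (P.eval (-a))).natDegree = 1 + Q.natDegree := by
      rw [hQ, Polynomial.natDegree_mul (Polynomial.X_sub_C_ne_zero _) hQ0,
        Polynomial.natDegree_X_sub_C]
    have h2 := Polynomial.natDegree_sub_C (p := P) (a := P.eval (-a))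
    omega

/-- The polynomial in `y` that interpolates `d! * C(b + d + y, d)`. -/
noncomputable def choosePoly (b d : ℕ) : Polynomial ℝ :=
  ∏ l ∈ range d, (Polynomial.X + Polynomial.C ((b : ℝ) + 1 + l))

theorem natDegree_choosePoly (b d : ℕ) : (choosePoly b d).natDegree = d := by
  rw [choosePoly, Polynomial.natDegree_prod_of_monic _ _ fun l _ => Polynomial.monic_X_add_C _]
  simp only [Polynomial.natDegree_X_add_C, sum_const, card_range, smul_eq_mul, mul_one]

theorem eval_choosePoly (b d : ℕ) (y : ℝ) :
    (choosePoly b d).eval y = ∏ l ∈ range d, (y + ((b : ℝ) + 1 + l)) := by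
  simp [choosePoly, Polynomial.eval_prod]

theorem eval_choosePoly_nat (b d i : ℕ) :
    (choosePoly b d).eval (i : ℝ) = d.factorial * ((b + d + i).choose d : ℝ) := by
  rw [eval_choosePoly]
  have := Nat.ascFactorial_eq_factorial_mul_choose (b + i) d
  rw [show b + d + i = b + i + d by ring]
  rw [← Nat.cast_mul, ← this, Nat.ascFactorial_eq_prod_range]
  push_cast
  exact prod_congr rfl fun l _ => by ring

/-- The `j`-th coefficient of the Chelyshkov polynomial. -/
noncomputable def coeffC (N n j : ℕ) : ℝ :=
  (-1 : ℝ) ^ (j - n) * ((N - n).choose (j - n) : ℝ) * ((N + j + 1).choose (N - n) : ℝ)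

/-- With `j = n + i` and `d = N - n`, the second binomial is a polynomial of degree `d` in `i`. The
pole is at `-(m + n + 1)`, and the numerator on the right is the value of the polynomial there, up
to `d!`. -/
theorem sum_coeffC_div {N n : ℕ} (hn : n ≤ N) (m : ℕ) :
    ∑ j ∈ Icc n N, coeffC N n j / ((m : ℝ) + j + 1) =
      (∏ l ∈ range (N - n), ((n : ℝ) + 1 + l - m)) / ∏ i ∈ range (N - n + 1), ((m : ℝ) + n + 1 + i)
      := by
  obtain ⟨d, rfl⟩ := Nat.exists_eq_add_of_le hn
  have hd : n + d - n = d := by omega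
  have key := sum_neg_one_pow_choose_eval_div (natDegree_choosePoly (2 * n + 1) d).le
    (a := (m : ℝ) + n + 1) (by positivity)
  have hf : (d.factorial : ℝ) ≠ 0 := by positivity
  have hs : ∑ j ∈ Icc n (n + d), coeffC (n + d) n j / ((m : ℝ) + j + 1) =
      (d.factorial : ℝ)⁻¹ * ∑ i ∈ range (d + 1), (-1 : ℝ) ^ i * (d.choose i : ℝ) *
        (choosePoly (2 * n + 1) d).eval (i : ℝ) / ((m : ℝ) + n + 1 + i) := by
    rw [mul_sum, ← Ico_succ_right_eq_Icc, sum_Ico_eq_sum_range]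
    have : Order.succ (n + d) - n = d + 1 := by simp; omega
    rw [this]
    refine sum_congr rfl fun i _ => ?_
    rw [eval_choosePoly_nat, coeffC, hd, Nat.add_sub_cancel_left,
      show n + d + (n + i) + 1 = 2 * n + 1 + d + i by ring]
    push_cast
    rw [show (m : ℝ) + (n + i) + 1 = m + n + 1 + i by ring]
    field_simp
  rw [hs, key, eval_choosePoly, hd]
  have : ∏ l ∈ range d, (-((m : ℝ) + n + 1) + (((2 * n + 1 : ℕ) : ℝ) + 1 + l)) =
      ∏ l ∈ range d, ((n : ℝ) + 1 + l - m) :=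
    prod_congr rfl fun l _ => by push_cast; ring
  rw [this]
  field_simp

/-- The factor `l = m - n - 1` of the numerator is zero. -/
theorem sum_coeffC_div_eq_zero {N n m : ℕ} (hnm : n < m) (hm : m ≤ N) :
    ∑ j ∈ Icc n N, coeffC N n j / ((m : ℝ) + j + 1) = 0 := by
  rw [sum_coeffC_div (hnm.le.trans hm)]
  rw [prod_eq_zero (i := m - n - 1) (by simp; omega), zero_div]
  rw [Nat.cast_sub (by omega), Nat.cast_sub hnm.le]
  push_cast
  ring

theorem coeffC_self (N n : ℕ) : coeffC N n n = ((N + n + 1).choose (N - n) : ℝ) := by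
  simp [coeffC]

theorem coeffC_self_pos (N n : ℕ) : 0 < coeffC N n n := by
  rw [coeffC_self]
  exact_mod_cast Nat.choose_pos (by omega)

/-- For `m = n` the numerator is `d!` and the denominator is `(2n+1) d!` times the binomial `coeffC
N n n`. -/
theorem coeffC_self_mul_sum_div {N n : ℕ} (hn : n ≤ N) :
    coeffC N n n * ∑ j ∈ Icc n N, coeffC N n j / ((n : ℝ) + j + 1) = 1 / (2 * (n : ℝ) + 1) := by
  rw [sum_coeffC_div hn, coeffC_self]
  obtain ⟨d, rfl⟩ := Nat.exists_eq_add_of_le hn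
  rw [Nat.add_sub_cancel_left]
  have h1 : ∏ l ∈ range d, ((n : ℝ) + 1 + l - n) = d.factorial := by
    rw [← prod_range_add_one_eq_factorial]
    push_cast
    exact prod_congr rfl fun l _ => by ring
  have h2 := eval_choosePoly_nat (2 * n + 1) d 0
  rw [eval_choosePoly] at h2
  rw [prod_range_succ', h1, show n + d + n + 1 = 2 * n + 1 + d + 0 by ring]
  have h3 : ∏ k ∈ range d, ((n : ℝ) + n + 1 + ((k + 1 : ℕ) : ℝ)) =
      d.factorial * ((2 * n + 1 + d + 0).choose d : ℝ) := by
    rw [← h2]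
    exact prod_congr rfl fun l _ => by push_cast; ring
  rw [h3]
  have hc : (0 : ℝ) < ((2 * n + 1 + d + 0).choose d : ℝ) := by
    exact_mod_cast Nat.choose_pos (by omega)
  have hf : (d.factorial : ℝ) ≠ 0 := by positivity
  push_cast
  field_simp
  ring

end Algebra

/-! ### Weighted inner product, orthogonality and projection. -/

section Weighted

open Finset MeasureTheory

variable {ν : ℝ}

theorem intervalIntegrable_mul_weight (hν : 0 < ν) {u : ℝ → ℝ} (hu : Continuous u) (a b : ℝ) :
    IntervalIntegrable (fun x => u x * x ^ (ν - 1)) volume a b :=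
  (intervalIntegral.intervalIntegrable_rpow' (by linarith)).continuousOn_mul hu.continuousOn

theorem wInner_comm (u v : ℝ → ℝ) : wInner ν u v = wInner ν v u := by
  simp only [wInner, mul_comm (u _)]

theorem wInner_congr {u u' v v' : ℝ → ℝ} (hu : Set.EqOn u u' (Set.Ioc 0 1))
    (hv : Set.EqOn v v' (Set.Ioc 0 1)) : wInner ν u v = wInner ν u' v' := by
  refine intervalIntegral.integral_congr_ae (.of_forall fun x hx => ?_)
  rw [Set.uIoc_of_le zero_le_one] at hx
  rw [hu hx, hv hx]

theorem wNorm_congr {u u' : ℝ → ℝ} (hu : Set.EqOn u u' (Set.Ioc 0 1)) :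
    wNorm ν u = wNorm ν u' := by
  rw [wNorm, wNorm, wInner_congr hu hu]

theorem wInner_sum_left (hν : 0 < ν) {ι : Type*} (s : Finset ι) (c : ι → ℝ) {f : ι → ℝ → ℝ}
    (hf : ∀ i ∈ s, Continuous (f i)) {v : ℝ → ℝ} (hv : Continuous v) :
    wInner ν (fun x => ∑ i ∈ s, c i * f i x) v = ∑ i ∈ s, c i * wInner ν (f i) v := by
  simp only [wInner, ← intervalIntegral.integral_const_mul]
  rw [← intervalIntegral.integral_finsetSum]
  · simp only [sum_mul, mul_assoc]
  · intro i hi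
    exact (intervalIntegrable_mul_weight hν ((hf i hi).mul hv) 0 1).const_mul (c i)

theorem wInner_sum_right (hν : 0 < ν) {ι : Type*} (s : Finset ι) (c : ι → ℝ) {f : ι → ℝ → ℝ}
    (hf : ∀ i ∈ s, Continuous (f i)) {v : ℝ → ℝ} (hv : Continuous v) :
    wInner ν v (fun x => ∑ i ∈ s, c i * f i x) = ∑ i ∈ s, c i * wInner ν v (f i) := by
  simp only [wInner_comm v, wInner_sum_left hν s c hf hv]

theorem wInner_add_left (hν : 0 < ν) {u u' v : ℝ → ℝ} (hu : Continuous u) (hu' : Continuous u')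
    (hv : Continuous v) :
    wInner ν (fun x => u x + u' x) v = wInner ν u v + wInner ν u' v := by
  simp only [wInner, add_mul]
  exact intervalIntegral.integral_add (intervalIntegrable_mul_weight hν (hu.mul hv) 0 1)
    (intervalIntegrable_mul_weight hν (hu'.mul hv) 0 1)

theorem wInner_sub_left (hν : 0 < ν) {u u' v : ℝ → ℝ} (hu : Continuous u) (hu' : Continuous u')
    (hv : Continuous v) :
    wInner ν (fun x => u x - u' x) v = wInner ν u v - wInner ν u' v := by
  simp only [wInner, sub_mul]
  exact intervalIntegral.integral_sub (intervalIntegrable_mul_weight hν (hu.mul hv) 0 1)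
    (intervalIntegrable_mul_weight hν (hu'.mul hv) 0 1)

theorem wInner_add_right (hν : 0 < ν) {u u' v : ℝ → ℝ} (hu : Continuous u) (hu' : Continuous u')
    (hv : Continuous v) :
    wInner ν v (fun x => u x + u' x) = wInner ν v u + wInner ν v u' := by
  simp only [wInner_comm v, wInner_add_left hν hu hu' hv]

theorem wInner_sub_right (hν : 0 < ν) {u u' v : ℝ → ℝ} (hu : Continuous u) (hu' : Continuous u')
    (hv : Continuous v) :
    wInner ν v (fun x => u x - u' x) = wInner ν v u - wInner ν v u' := by
  simp only [wInner_comm v, wInner_sub_left hν hu hu' hv]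

theorem wInner_const_mul_left (c : ℝ) (u v : ℝ → ℝ) :
    wInner ν (fun x => c * u x) v = c * wInner ν u v := by
  simp only [wInner, ← intervalIntegral.integral_const_mul, mul_assoc]

theorem wInner_const_mul_right (c : ℝ) (u v : ℝ → ℝ) :
    wInner ν v (fun x => c * u x) = c * wInner ν v u := by
  simp only [wInner_comm v, wInner_const_mul_left]

theorem wInner_self_nonneg (u : ℝ → ℝ) : 0 ≤ wInner ν u u := by
  refine intervalIntegral.integral_nonneg zero_le_one fun x hx => ?_
  have := Real.rpow_nonneg hx.1 (ν - 1)
  exact mul_nonneg (mul_self_nonneg _) this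

theorem wNorm_sq (u : ℝ → ℝ) : wNorm ν u ^ 2 = wInner ν u u :=
  Real.sq_sqrt (wInner_self_nonneg u)

theorem wNorm_nonneg (u : ℝ → ℝ) : 0 ≤ wNorm ν u := Real.sqrt_nonneg _

theorem wInner_mul_self_le (hν : 0 < ν) {u v : ℝ → ℝ} (hu : Continuous u) (hv : Continuous v) :
    wInner ν u v * wInner ν u v ≤ wInner ν u u * wInner ν v v := by
  have h : ∀ t : ℝ, 0 ≤ wInner ν v v * (t * t) + (2 * wInner ν u v) * t + wInner ν u u := by
    intro t
    have ht : Continuous fun x => t * v x := hv.const_mul t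
    have hs : Continuous fun x => u x + t * v x := hu.add ht
    have := wInner_self_nonneg (ν := ν) fun x => u x + t * v x
    rw [wInner_add_left hν hu ht hs, wInner_add_right hν hu ht hu,
      wInner_add_right hν hu ht ht] at this
    simp only [wInner_const_mul_left, wInner_const_mul_right] at this
    rw [wInner_comm v u] at this
    linarith
  have := discrim_le_zero h
  rw [discrim] at this
  linarith

theorem wInner_le_wNorm_mul (hν : 0 < ν) {u v : ℝ → ℝ} (hu : Continuous u) (hv : Continuous v) :
    wInner ν u v ≤ wNorm ν u * wNorm ν v := by
  rw [wNorm, wNorm, ← Real.sqrt_mul (wInner_self_nonneg u)]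
  apply Real.le_sqrt_of_sq_le
  rw [sq]
  exact wInner_mul_self_le hν hu hv

theorem wNorm_add_le (hν : 0 < ν) {u v : ℝ → ℝ} (hu : Continuous u) (hv : Continuous v) :
    wNorm ν (fun x => u x + v x) ≤ wNorm ν u + wNorm ν v := by
  have hs : Continuous fun x => u x + v x := hu.add hv
  refine Real.sqrt_le_iff.2 ⟨add_nonneg (wNorm_nonneg u) (wNorm_nonneg v), ?_⟩
  rw [wInner_add_left hν hu hv hs, wInner_add_right hν hu hv hu,
    wInner_add_right hν hu hv hv, wInner_comm v u, add_sq, wNorm_sq, wNorm_sq]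
  linarith [wInner_le_wNorm_mul hν hu hv]

theorem wNorm_const_mul (c : ℝ) (u : ℝ → ℝ) : wNorm ν (fun x => c * u x) = |c| * wNorm ν u := by
  rw [wNorm, wInner_const_mul_left, wInner_const_mul_right, ← mul_assoc,
    Real.sqrt_mul (mul_self_nonneg c), Real.sqrt_mul_self_eq_abs, wNorm]

theorem wNorm_sum_le (hν : 0 < ν) {ι : Type*} (s : Finset ι) (c : ι → ℝ) {f : ι → ℝ → ℝ}
    (hf : ∀ i, Continuous (f i)) :
    wNorm ν (fun x => ∑ i ∈ s, c i * f i x) ≤ ∑ i ∈ s, |c i| * wNorm ν (f i) := by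
  classical
  induction s using Finset.induction_on with
  | empty => simp [wNorm, wInner]
  | insert a s ha ih =>
    simp only [sum_insert ha]
    refine (wNorm_add_le hν ((hf a).const_mul _)
      (continuous_finsetSum _ fun i _ => (hf i).const_mul _)).trans ?_
    rw [wNorm_const_mul]
    gcongr

theorem wInner_rpow_rpow (hν : 0 < ν) {p q : ℝ} (hp : 0 ≤ p) (hq : 0 ≤ q) :
    wInner ν (fun x => x ^ p) (fun x => x ^ q) = 1 / (p + q + ν) := by
  have : wInner ν (fun x => x ^ p) (fun x => x ^ q) = ∫ x in (0 : ℝ)..1, x ^ (p + q + ν - 1) := by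
    refine intervalIntegral.integral_congr_ae (.of_forall fun x hx => ?_)
    rw [Set.uIoc_of_le zero_le_one] at hx
    simp only
    rw [← Real.rpow_add hx.1, ← Real.rpow_add hx.1, add_sub_assoc]
  rw [this, integral_rpow (Or.inl (by linarith)), sub_add_cancel, Real.one_rpow,
    Real.zero_rpow (by positivity), sub_zero]

theorem continuous_rpow_natMul_add (hν : 0 < ν) {α : ℝ} (hα : 0 ≤ α) (j : ℕ) :
    Continuous (fracMonomial α ν j) :=
  Real.continuous_rpow_const (by positivity)

theorem chelyshkov_eq_sum (N n : ℕ) :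
    chelyshkov ν N n = fun x => ∑ j ∈ Icc n N, coeffC N n j * fracMonomial 0 ν j x := by
  funext x
  simp [chelyshkov, coeffC, fracMonomial]

theorem continuous_chelyshkov (hν : 0 < ν) (N n : ℕ) : Continuous (chelyshkov ν N n) := by
  rw [chelyshkov_eq_sum]
  exact continuous_finsetSum _ fun j _ => (continuous_rpow_natMul_add hν le_rfl j).const_mul _

theorem wInner_fracMonomial_chelyshkov (hν : 0 < ν) (N n m : ℕ) :
    wInner ν (fracMonomial 0 ν m) (chelyshkov ν N n) =
      ν⁻¹ * ∑ j ∈ Icc n N, coeffC N n j / ((m : ℝ) + j + 1) := by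
  rw [chelyshkov_eq_sum, wInner_sum_right hν _ _
    (fun j _ => continuous_rpow_natMul_add hν le_rfl j) (continuous_rpow_natMul_add hν le_rfl m),
    mul_sum]
  refine sum_congr rfl fun j _ => ?_
  have := wInner_rpow_rpow hν (p := (m : ℝ) * ν + 0) (q := (j : ℝ) * ν + 0)
    (by positivity) (by positivity)
  unfold fracMonomial
  rw [this, show (m : ℝ) * ν + 0 + (j * ν + 0) + ν = ν * (m + j + 1) by ring]
  have : (0 : ℝ) < m + j + 1 := by positivity
  field_simp

/-- The polynomial of index `k` contains only powers `x^(jν)` with `n < k ≤ j ≤ N`, each orthogonal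
to the polynomial of index `n`. -/
theorem wInner_chelyshkov_of_lt (hν : 0 < ν) {N n k : ℕ} (h : n < k) :
    wInner ν (chelyshkov ν N k) (chelyshkov ν N n) = 0 := by
  rw [chelyshkov_eq_sum N k, wInner_sum_left hν _ _
    (fun j _ => continuous_rpow_natMul_add hν le_rfl j) (continuous_chelyshkov hν N n)]
  refine sum_eq_zero fun j hj => ?_
  rw [mem_Icc] at hj
  rw [wInner_fracMonomial_chelyshkov hν, sum_coeffC_div_eq_zero (by omega) hj.2]
  simp

theorem wInner_chelyshkov_of_ne (hν : 0 < ν) {N n k : ℕ} (h : n ≠ k) :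
    wInner ν (chelyshkov ν N n) (chelyshkov ν N k) = 0 := by
  rcases lt_or_gt_of_ne h with h | h
  · rw [wInner_comm, wInner_chelyshkov_of_lt hν h]
  · exact wInner_chelyshkov_of_lt hν h

theorem wInner_chelyshkov_self (hν : 0 < ν) {N n : ℕ} (hn : n ≤ N) :
    wInner ν (chelyshkov ν N n) (chelyshkov ν N n) = (ν * (2 * (n : ℝ) + 1))⁻¹ := by
  have : wInner ν (chelyshkov ν N n) (chelyshkov ν N n) =
      coeffC N n n * wInner ν (fracMonomial 0 ν n) (chelyshkov ν N n) := by
    nth_rw 1 [chelyshkov_eq_sum N n]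
    rw [wInner_sum_left hν _ _
      (fun j _ => continuous_rpow_natMul_add hν le_rfl j) (continuous_chelyshkov hν N n)]
    refine sum_eq_single_of_mem n (by simp [hn]) fun j hj hne => ?_
    rw [mem_Icc] at hj
    rw [wInner_fracMonomial_chelyshkov hν, sum_coeffC_div_eq_zero (by omega) hj.2]
    simp
  rw [this, wInner_fracMonomial_chelyshkov hν, mul_left_comm, coeffC_self_mul_sum_div hn,
    mul_inv, one_div]

/-- The polynomials of indices `0, …, N` span the monomials `x^(mν)`, `m ≤ N`. -/
theorem wInner_fracMonomial_eq_zero (hν : 0 < ν) {N : ℕ} {r : ℝ → ℝ} (hr : Continuous r)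
    (h : ∀ k ≤ N, wInner ν r (chelyshkov ν N k) = 0) :
    ∀ m ≤ N, wInner ν r (fracMonomial 0 ν m) = 0 := by
  -- Descending induction on `m`: the polynomial of index `m` is a nonzero multiple of `x^(mν)` plus
  -- higher powers.
  have key : ∀ d m : ℕ, m + d = N → wInner ν r (fracMonomial 0 ν m) = 0 := by
    intro d
    induction d using Nat.strong_induction_on with
    | _ d ih =>
      intro m hm
      have h1 := h m (by omega)
      rw [chelyshkov_eq_sum, wInner_sum_right hν _ _
        (fun j _ => continuous_rpow_natMul_add hν le_rfl j) hr,
        sum_eq_single_of_mem m (by simp; omega)] at h1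
      · exact (mul_eq_zero.1 h1).resolve_left (coeffC_self_pos N m).ne'
      · intro j hj hne
        rw [mem_Icc] at hj
        rw [ih (N - j) (by omega) j (by omega), mul_zero]
  exact fun m hm => key (N - m) m (by omega)

theorem continuous_monomialError {α : ℝ} (hν : 0 < ν) (hα : 0 ≤ α) (N j : ℕ) :
    Continuous (monomialError α ν N j) :=
  (continuous_rpow_natMul_add hν hα j).sub
    (continuous_finsetSum _ fun k _ => (continuous_chelyshkov hν N k).const_mul _)

theorem wInner_sum_chelyshkov (hν : 0 < ν) (N : ℕ) (c : Fin (N + 1) → ℝ) (k : Fin (N + 1)) :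
    wInner ν (fun x => ∑ i : Fin (N + 1), c i * chelyshkov ν N i x) (chelyshkov ν N k) =
      c k * (ν * (2 * (k : ℝ) + 1))⁻¹ := by
  rw [wInner_sum_left hν _ c (f := fun i : Fin (N + 1) => chelyshkov ν N i)
    (fun i _ => continuous_chelyshkov hν N i) (continuous_chelyshkov hν N k), sum_eq_single k]
  · rw [wInner_chelyshkov_self hν (by omega)]
  · intro i _ hi
    rw [wInner_chelyshkov_of_ne hν (fun h => hi (Fin.ext h)), mul_zero]
  · simp

theorem wInner_monomialError_chelyshkov {α : ℝ} (hν : 0 < ν) (hα : 0 ≤ α) (N j : ℕ)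
    (k : Fin (N + 1)) : wInner ν (monomialError α ν N j) (chelyshkov ν N k) = 0 := by
  have h := wInner_sum_chelyshkov hν N (fun k => xi α ν N k j) k
  have hk : (0 : ℝ) < 2 * (k : ℝ) + 1 := by positivity
  have hs : Continuous fun x => ∑ i : Fin (N + 1), xi α ν N i j * chelyshkov ν N i x :=
    continuous_finsetSum _ fun k _ => (continuous_chelyshkov hν N k).const_mul _
  unfold monomialError Phi
  rw [wInner_sub_left hν (continuous_rpow_natMul_add hν hα j) hs (continuous_chelyshkov hν N k), h,
    xi]
  field_simp
  ring

end Weighted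

/-! ### Fractional integrals, Gram determinants and the error as a projection error. -/

section FractionalIntegral

open Finset MeasureTheory

variable {α ν : ℝ}

theorem intervalIntegrable_sub_rpow (hα : 0 < α) (x a b : ℝ) :
    IntervalIntegrable (fun s => (x - s) ^ (α - 1)) volume a b := by
  have := (intervalIntegral.intervalIntegrable_rpow' (a := x - a) (b := x - b)
    (show -1 < α - 1 by linarith)).comp_sub_left x
  simpa using this

theorem intervalIntegrable_sub_rpow_mul (hα : 0 < α) {u : ℝ → ℝ} (hu : Continuous u) (x a b : ℝ) :
    IntervalIntegrable (fun s => (x - s) ^ (α - 1) * u s) volume a b :=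
  (intervalIntegrable_sub_rpow hα x a b).mul_continuousOn hu.continuousOn

theorem betaIntegral_ofReal {a b : ℝ} (ha : 0 < a) (hb : 0 < b) :
    Complex.betaIntegral a b = (ProbabilityTheory.beta b a : ℝ) := by
  rw [Complex.betaIntegral_eq_Gamma_mul_div _ _ (by simpa) (by simpa), ← Complex.ofReal_add,
    Complex.Gamma_ofReal, Complex.Gamma_ofReal, Complex.Gamma_ofReal, ProbabilityTheory.beta,
    add_comm b a, mul_comm (Real.Gamma b)]
  norm_cast

theorem integral_sub_rpow_mul_rpow (hα : 0 < α) {p x : ℝ} (hp : 0 ≤ p) (hx : 0 < x) :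
    ∫ s in (0 : ℝ)..x, (x - s) ^ (α - 1) * s ^ p =
      ProbabilityTheory.beta α (p + 1) * x ^ (p + α) := by
  have h := Complex.betaIntegral_scaled ((p + 1 : ℝ) : ℂ) (α : ℂ) hx
  rw [betaIntegral_ofReal (by positivity) hα] at h
  have h2 : ∫ s in (0 : ℝ)..x, (s : ℂ) ^ (((p + 1 : ℝ) : ℂ) - 1) * ((x : ℂ) - s) ^ ((α : ℂ) - 1) =
      ((∫ s in (0 : ℝ)..x, (x - s) ^ (α - 1) * s ^ p : ℝ) : ℂ) := by
    rw [← intervalIntegral.integral_ofReal]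
    refine intervalIntegral.integral_congr fun s hs => ?_
    rw [Set.uIcc_of_le hx.le] at hs
    have e1 : (((p + 1 : ℝ) : ℂ) - 1) = (p : ℂ) := by push_cast; ring
    have e2 : ((α : ℂ) - 1) = ((α - 1 : ℝ) : ℂ) := by push_cast; ring
    rw [e1, e2, ← Complex.ofReal_sub, ← Complex.ofReal_cpow hs.1,
      ← Complex.ofReal_cpow (sub_nonneg.2 hs.2), ← Complex.ofReal_mul, mul_comm]
  have e : (((p + 1 : ℝ) : ℂ) + α - 1) = ((p + α : ℝ) : ℂ) := by push_cast; ring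
  rw [h2, e, ← Complex.ofReal_cpow hx.le, ← Complex.ofReal_mul] at h
  rw [Complex.ofReal_inj.1 h, mul_comm]

theorem integral_sub_rpow_mul_chelyshkov (hα : 0 < α) (hν : 0 < ν) (N n : ℕ) {x : ℝ} (hx : 0 < x) :
    ∫ s in (0 : ℝ)..x, (x - s) ^ (α - 1) * chelyshkov ν N n s =
      ∑ j ∈ Icc n N, coeffC N n j * ProbabilityTheory.beta α ((j : ℝ) * ν + 1) *
        fracMonomial α ν j x := by
  simp only [chelyshkov_eq_sum, mul_sum]
  rw [intervalIntegral.integral_finsetSum]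
  · refine sum_congr rfl fun j _ => ?_
    have := integral_sub_rpow_mul_rpow hα (p := (j : ℝ) * ν) (by positivity) hx
    rw [fracMonomial, mul_assoc, ← this, ← intervalIntegral.integral_const_mul]
    congr 1
    funext s
    rw [fracMonomial, add_zero]
    ring
  · intro j _
    exact intervalIntegrable_sub_rpow_mul hα
      ((continuous_rpow_natMul_add hν le_rfl j).const_mul _) x 0 x

/-- The continuous function on the line that agrees with `e_n` on `(0, 1]`. -/
noncomputable def errorSum (α ν : ℝ) (N n : ℕ) (x : ℝ) : ℝ :=
  ∑ j ∈ Icc n N, (coeffC N n j * ProbabilityTheory.beta α ((j : ℝ) * ν + 1)) *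
    monomialError α ν N j x

theorem continuous_errorSum (hα : 0 < α) (hν : 0 < ν) (N n : ℕ) :
    Continuous (errorSum α ν N n) :=
  continuous_finsetSum _ fun j _ => (continuous_monomialError hν hα.le N j).const_mul _

theorem errorVec_eq_errorSum (hα : 0 < α) (hν : 0 < ν) (N : ℕ) (n : Fin (N + 1)) :
    Set.EqOn (errorVec α ν N n) (errorSum α ν N n) (Set.Ioc 0 1) := by
  intro x hx
  simp only [errorVec, errorSum, Phi, monomialError]
  rw [integral_sub_rpow_mul_chelyshkov hα hν N n hx.1]
  simp only [mul_sub, sum_sub_distrib]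
  congr 1
  simp only [Matrix.mulVec, dotProduct, opMatrix, Matrix.of_apply, Theta, mul_sum, sum_mul, Phi]
  rw [sum_comm]
  refine sum_congr rfl fun j _ => sum_congr rfl fun k _ => ?_
  rw [coeffC]
  ring

theorem memWL2_of_eqOn (hν : 0 < ν) {u v : ℝ → ℝ} (hv : Continuous v)
    (h : Set.EqOn u v (Set.Ioc 0 1)) : MemWL2 ν u := by
  have hae : u =ᵐ[volume.restrict (Set.Icc 0 1)] v := by
    rw [← Measure.restrict_congr_set Ioc_ae_eq_Icc]
    exact (ae_restrict_iff' measurableSet_Ioc).2 (.of_forall h)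
  refine ⟨hv.aestronglyMeasurable.congr hae.symm, ?_⟩
  have hi := intervalIntegrable_mul_weight hν (hv.pow 2) 0 1
  rw [intervalIntegrable_iff_integrableOn_Icc_of_le zero_le_one] at hi
  refine Integrable.congr hi ?_
  filter_upwards [hae] with x hx
  simp [hx]

theorem gramDet_chelyshkov_pos (hν : 0 < ν) (N : ℕ) :
    0 < gramDet ν (fun k : Fin (N + 1) => chelyshkov ν N k) := by
  have : (Matrix.of fun i j : Fin (N + 1) => wInner ν (chelyshkov ν N i) (chelyshkov ν N j)) =
      Matrix.diagonal fun i : Fin (N + 1) => (ν * (2 * (i : ℝ) + 1))⁻¹ := by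
    ext i j
    rcases eq_or_ne i j with rfl | hij
    · simp [wInner_chelyshkov_self hν (show (i : ℕ) ≤ N by omega)]
    · simp [hij, wInner_chelyshkov_of_ne hν (fun h => hij (Fin.ext h))]
  rw [gramDet, this, Matrix.det_diagonal]
  exact prod_pos fun i _ => by positivity

/-- Gram determinants split off the component orthogonal to the remaining functions. -/
theorem gramDet_vecCons (hν : 0 < ν) {m : ℕ} {f : Fin m → ℝ → ℝ} (hf : ∀ k, Continuous (f k))
    {u : ℝ → ℝ} (hu : Continuous u) (c : Fin m → ℝ)
    (h : ∀ k, wInner ν (fun x => u x - ∑ i, c i * f i x) (f k) = 0) :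
    gramDet ν (Matrix.vecCons u f) =
      wInner ν (fun x => u x - ∑ i, c i * f i x) (fun x => u x - ∑ i, c i * f i x) *
        gramDet ν f := by
  have hs : Continuous fun x => ∑ i, c i * f i x :=
    continuous_finsetSum _ fun k _ => (hf k).const_mul _
  set r : ℝ → ℝ := fun x => u x - ∑ i, c i * f i x with hr
  have hrc : Continuous r := hu.sub hs
  have hcons : ∀ j, Continuous (Matrix.vecCons u f j) := fun j => by
    refine Fin.cases ?_ (fun k => ?_) j
    · simpa using hu
    · simpa using hf k
  set M : Matrix (Fin (m + 1)) (Fin (m + 1)) ℝ :=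
    Matrix.of fun i j => wInner ν (Matrix.vecCons u f i) (Matrix.vecCons u f j) with hM
  -- Subtracting `c i` times the other rows from row `0` turns it into the inner products with `r`,
  -- without changing the determinant. All its entries except the first vanish.
  have hrow : ∑ k, (Matrix.vecCons 1 (fun i => -c i) : Fin (m + 1) → ℝ) k • M k =
      fun j => wInner ν r (Matrix.vecCons u f j) := by
    funext j
    rw [Fin.sum_univ_succ]
    simp only [Matrix.cons_val_zero, Matrix.cons_val_succ, Pi.add_apply, Finset.sum_apply, Pi.smul_apply,
      smul_eq_mul, hM, Matrix.of_apply, hr]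
    rw [wInner_sub_left hν hu hs (hcons j), wInner_sum_left hν _ _ (fun k _ => hf k) (hcons j)]
    simp [sub_eq_add_neg]
  have hdet := Matrix.det_updateRow_sum M 0 (Matrix.vecCons 1 fun i => -c i)
  rw [hrow] at hdet
  simp only [Matrix.cons_val_zero, one_smul] at hdet
  rw [gramDet, ← hM, ← hdet, Matrix.det_succ_row_zero, Fin.sum_univ_succ]
  have h0 : wInner ν r u = wInner ν r r := by
    have : wInner ν r r = wInner ν r u - wInner ν r (fun x => ∑ i, c i * f i x) :=
      wInner_sub_right hν hu hs hrc
    rw [this, wInner_sum_right hν _ _ (fun k _ => hf k) hrc]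
    simp [h]
  rw [sum_eq_zero]
  · simp only [Matrix.updateRow_self, Matrix.cons_val_zero, h0, gramDet]
    simp only [Fin.val_zero, pow_zero, one_mul, add_zero]
    congr 2
  · intro k _
    simp [h k]

theorem wNorm_monomialError_sq (hα : 0 < α) (hν : 0 < ν) (N j : ℕ) :
    wNorm ν (monomialError α ν N j) ^ 2 = gramRatio ν N (fracMonomial α ν j) := by
  have h := gramDet_vecCons hν (f := fun k : Fin (N + 1) => chelyshkov ν N k)
    (fun k => continuous_chelyshkov hν N k) (continuous_rpow_natMul_add hν hα.le j)
    (fun k => xi α ν N k j) (wInner_monomialError_chelyshkov hν hα.le N j)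
  rw [gramRatio, h, mul_div_cancel_right₀ _ (gramDet_chelyshkov_pos hν N).ne', wNorm_sq]
  rfl

theorem wNorm_errorVec_le (hα : 0 < α) (hν : 0 < ν) (N : ℕ) (n : Fin (N + 1)) :
    wNorm ν (errorVec α ν N n) ≤
      ∑ j ∈ Icc (n : ℕ) N,
        ((N - (n : ℕ)).choose (j - (n : ℕ)) : ℝ) * ((N + j + 1).choose (N - (n : ℕ)) : ℝ) *
          ProbabilityTheory.beta α ((j : ℝ) * ν + 1) *
          Real.sqrt (gramRatio ν N (fracMonomial α ν j)) := by
  rw [wNorm_congr (errorVec_eq_errorSum hα hν N n)]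
  refine (wNorm_sum_le hν _ _ fun j => continuous_monomialError hν hα.le N j).trans_eq ?_
  refine sum_congr rfl fun j _ => ?_
  rw [← wNorm_monomialError_sq hα hν, Real.sqrt_sq (wNorm_nonneg _), coeffC, abs_mul, abs_mul,
    abs_mul, abs_pow, abs_neg, abs_one, one_pow, one_mul, Nat.abs_cast, Nat.abs_cast,
    abs_of_pos (ProbabilityTheory.beta_pos hα (by positivity))]

/-- The error is orthogonal to the fractional Chelyshkov polynomials. -/
theorem wInner_errorSum_chelyshkov (hα : 0 < α) (hν : 0 < ν) (N n : ℕ) {k : ℕ} (hk : k ≤ N) :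
    wInner ν (errorSum α ν N n) (chelyshkov ν N k) = 0 := by
  unfold errorSum
  rw [wInner_sum_left hν _ _ (fun j _ => continuous_monomialError hν hα.le N j)
    (continuous_chelyshkov hν N k)]
  refine sum_eq_zero fun j _ => ?_
  have := wInner_monomialError_chelyshkov hν hα.le N j ⟨k, by omega⟩
  simp only at this
  rw [this, mul_zero]

/-- The fractional integral of the polynomial of index `n`, as a continuous function on the line. -/
noncomputable def fracIntegral (α ν : ℝ) (N n : ℕ) (x : ℝ) : ℝ :=
  ∑ j ∈ Icc n N, (coeffC N n j * ProbabilityTheory.beta α ((j : ℝ) * ν + 1)) *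
    fracMonomial α ν j x

theorem continuous_fracIntegral (hα : 0 < α) (hν : 0 < ν) (N n : ℕ) :
    Continuous (fracIntegral α ν N n) :=
  continuous_finsetSum _ fun j _ => (continuous_rpow_natMul_add hν hα.le j).const_mul _

theorem fracIntegral_eq (hα : 0 < α) (hν : 0 < ν) (N n : ℕ) {x : ℝ} (hx : 0 < x) :
    fracIntegral α ν N n x = ∫ s in (0 : ℝ)..x, (x - s) ^ (α - 1) * chelyshkov ν N n s :=
  (integral_sub_rpow_mul_chelyshkov hα hν N n hx).symm

/-- Best approximation: `e` is orthogonal to the span, so `⟨e, w⟩ = ⟨e, e⟩` for every competitor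
`w`, and Cauchy–Schwarz concludes. -/
theorem wInner_errorSum_le (hα : 0 < α) (hν : 0 < ν) (N n : ℕ) (a : ℕ → ℝ) {m : ℕ} (hm : m ≤ N) :
    wInner ν (errorSum α ν N n) (errorSum α ν N n) ≤
      wInner ν
        (fun x => fracIntegral α ν N n x - ∑ i ∈ range (m + 1), a i * fracMonomial 0 ν i x)
        (fun x => fracIntegral α ν N n x - ∑ i ∈ range (m + 1), a i * fracMonomial 0 ν i x) := by
  set e := errorSum α ν N n with he
  have hec : Continuous e := continuous_errorSum hα hν N n
  have hFc := continuous_fracIntegral hα hν N n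
  have hvc : Continuous fun x => ∑ i ∈ range (m + 1), a i * fracMonomial 0 ν i x :=
    continuous_finsetSum _ fun i _ => (continuous_rpow_natMul_add hν le_rfl i).const_mul _
  have hv : wInner ν e (fun x => ∑ i ∈ range (m + 1), a i * fracMonomial 0 ν i x) = 0 := by
    rw [wInner_sum_right hν _ _ (fun i _ => continuous_rpow_natMul_add hν le_rfl i) hec]
    refine sum_eq_zero fun i hi => ?_
    rw [mem_range] at hi
    rw [wInner_fracMonomial_eq_zero hν hec
      (fun k hk => wInner_errorSum_chelyshkov hα hν N n hk) i (by omega), mul_zero]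
  have hq : ∀ j, Continuous fun x => ∑ k : Fin (N + 1), xi α ν N k j * Phi ν N x k := fun j =>
    continuous_finsetSum _ fun k _ => (continuous_chelyshkov hν N k).const_mul _
  have hF : wInner ν e (fracIntegral α ν N n) = wInner ν e e := by
    have hsplit : e = fun x => fracIntegral α ν N n x -
        ∑ j ∈ Icc n N, (coeffC N n j * ProbabilityTheory.beta α ((j : ℝ) * ν + 1)) *
          ∑ k : Fin (N + 1), xi α ν N k j * Phi ν N x k := by
      funext x
      simp only [he, errorSum, fracIntegral, monomialError, mul_sub, sum_sub_distrib]
    conv_rhs => arg 3; rw [hsplit]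
    rw [wInner_sub_right hν hFc (continuous_finsetSum _ fun j _ => (hq j).const_mul _) hec,
      wInner_sum_right hν _ _ (fun j _ => hq j) hec, sum_eq_zero, sub_zero]
    intro j _
    have := wInner_sum_right hν univ (fun k : Fin (N + 1) => xi α ν N k j)
      (f := fun k => chelyshkov ν N k) (fun k _ => continuous_chelyshkov hν N k) hec
    simp only [Phi, this]
    rw [sum_eq_zero, mul_zero]
    intro k _
    rw [wInner_errorSum_chelyshkov hα hν N n (by omega), mul_zero]
  set w : ℝ → ℝ := fun x =>
    fracIntegral α ν N n x - ∑ i ∈ range (m + 1), a i * fracMonomial 0 ν i x with hw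
  have hwc : Continuous w := hFc.sub hvc
  have hew : wInner ν e w = wInner ν e e := by
    rw [hw, wInner_sub_right hν hFc hvc hec, hv, hF, sub_zero]
  have hcs := wInner_mul_self_le hν hec hwc
  rw [hew] at hcs
  rcases (wInner_self_nonneg (ν := ν) e).eq_or_lt with h0 | h0
  · rw [← h0]
    exact wInner_self_nonneg w
  · exact le_of_mul_le_mul_left hcs h0

end FractionalIntegral

/-! ### Approximation and splitting of kernels. -/

section Kernel

open Finset MeasureTheory Filter Topology

variable {α ν : ℝ}

theorem natDegree_bernsteinPolynomial_le {m k : ℕ} (hk : k ≤ m) :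
    (bernsteinPolynomial ℝ m k).natDegree ≤ m := by
  have h1 : (1 - Polynomial.X : Polynomial ℝ).natDegree ≤ 1 := by compute_degree
  have h2 : ((1 - Polynomial.X : Polynomial ℝ) ^ (m - k)).natDegree ≤ m - k := by
    simpa using Polynomial.natDegree_pow_le_of_le (m - k) h1
  have h3 : ((m.choose k : Polynomial ℝ) * Polynomial.X ^ k).natDegree ≤ k := by
    have := Polynomial.natDegree_mul_le_of_le (Polynomial.natDegree_natCast (R := ℝ) (m.choose k)).le
      (Polynomial.natDegree_X_pow_le (R := ℝ) k)
    simpa using this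
  have := Polynomial.natDegree_mul_le_of_le h3 h2
  rw [bernsteinPolynomial]
  omega

/-- Continuous kernels on the unit square are uniformly approximated by kernels polynomial in the
first variable. -/
theorem exists_polynomial_kernel {G : ℝ → ℝ → ℝ} (hG : Continuous (Function.uncurry G))
    {δ : ℝ} (hδ : 0 < δ) :
    ∃ (m : ℕ) (b : Fin (m + 1) → Polynomial ℝ) (z : Fin (m + 1) → ℝ),
      (∀ k, (b k).natDegree ≤ m) ∧
      ∀ t ∈ Set.Icc (0 : ℝ) 1, ∀ s ∈ Set.Icc (0 : ℝ) 1,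
        |G t s - ∑ k, (b k).eval t * G (z k) s| ≤ δ := by
  let K : C(unitInterval × unitInterval, ℝ) :=
    ⟨fun p => G p.1 p.2, hG.comp (by fun_prop : Continuous fun p : unitInterval × unitInterval =>
      ((p.1 : ℝ), (p.2 : ℝ)))⟩
  -- Bernstein approximation of the curried kernel, a continuous function of `t` with values in
  -- `C([0,1])`; uniformity in `s` is built into the norm.
  have hT := (Metric.tendsto_atTop (α := C(unitInterval, C(unitInterval, ℝ)))
    (u := fun n => bernsteinApproximation n K.curry) (a := K.curry)).1
      (bernsteinApproximation_uniform K.curry)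
  obtain ⟨m, hm⟩ := hT δ hδ
  have hm := (hm m le_rfl).le
  refine ⟨m, fun k => bernsteinPolynomial ℝ m k, fun k => (bernstein.z k : unitInterval),
    fun k => natDegree_bernsteinPolynomial_le (by omega), fun t ht s hs => ?_⟩
  have h1 := (ContinuousMap.dist_apply_le_dist (f := bernsteinApproximation m K.curry)
    (g := K.curry) ⟨t, ht⟩)
  have h2 := (ContinuousMap.dist_apply_le_dist
    (f := bernsteinApproximation m K.curry ⟨t, ht⟩) (g := K.curry ⟨t, ht⟩) ⟨s, hs⟩)
  have h3 := (h2.trans h1).trans hm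
  rw [Real.dist_eq, abs_sub_comm] at h3
  have h4 : (bernsteinApproximation m K.curry ⟨t, ht⟩) ⟨s, hs⟩ =
      ∑ k : Fin (m + 1), (bernsteinPolynomial ℝ m k).eval t * G (bernstein.z k : unitInterval) s := by
    rw [bernsteinApproximation.apply, ContinuousMap.sum_apply]
    refine sum_congr rfl fun k _ => ?_
    simp [K, bernstein, Polynomial.toContinuousMapOn, Polynomial.toContinuousMap]
    exact Or.inl rfl
  rw [h4] at h3
  exact h3

/-- Cauchy–Schwarz for a nonnegative weight. -/
theorem sq_integral_mul_le {a b : ℝ} (hab : a ≤ b) {ω u : ℝ → ℝ}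
    (hω : IntervalIntegrable ω volume a b) (h0 : ∀ x ∈ Set.Icc a b, 0 ≤ ω x) (hu : Continuous u) :
    (∫ x in a..b, ω x * u x) ^ 2 ≤ (∫ x in a..b, ω x) * ∫ x in a..b, ω x * u x ^ 2 := by
  have i1 : IntervalIntegrable (fun x => ω x * u x) volume a b :=
    hω.mul_continuousOn hu.continuousOn
  have i2 : IntervalIntegrable (fun x => ω x * u x ^ 2) volume a b :=
    hω.mul_continuousOn (hu.pow 2).continuousOn
  have h : ∀ t : ℝ, 0 ≤ (∫ x in a..b, ω x) * (t * t) + (2 * ∫ x in a..b, ω x * u x) * t +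
      ∫ x in a..b, ω x * u x ^ 2 := by
    intro t
    have hnn : 0 ≤ ∫ x in a..b, ω x * (u x + t) ^ 2 :=
      intervalIntegral.integral_nonneg hab fun x hx => mul_nonneg (h0 x hx) (sq_nonneg _)
    have : ∀ x, ω x * (u x + t) ^ 2 = (t * t) * ω x + (2 * t) * (ω x * u x) + ω x * u x ^ 2 :=
      fun x => by ring
    simp only [this] at hnn
    rw [intervalIntegral.integral_add ((hω.const_mul _).add (i1.const_mul _)) i2,
      intervalIntegral.integral_add (hω.const_mul _) (i1.const_mul _),
      intervalIntegral.integral_const_mul, intervalIntegral.integral_const_mul] at hnn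
    linarith
  have := discrim_le_zero h
  rw [discrim] at this
  linarith

theorem tendsto_integral_rpow_mul_pow (hα : 0 < α) :
    Tendsto (fun l : ℕ => ∫ y in (0 : ℝ)..1, y ^ (α - 1) * (1 - y) ^ l) atTop (𝓝 0) := by
  have h := intervalIntegral.tendsto_integral_filter_of_dominated_convergence (μ := volume)
    (a := 0) (b := 1) (l := atTop) (F := fun (l : ℕ) (y : ℝ) => y ^ (α - 1) * (1 - y) ^ l)
    (f := fun _ => (0 : ℝ)) (fun y => y ^ (α - 1))
    (.of_forall fun l => by measurability) (.of_forall fun l => .of_forall fun y hy => ?_)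
    (intervalIntegral.intervalIntegrable_rpow' (by linarith)) (.of_forall fun y hy => ?_)
  · simpa using h
  · rw [Set.uIoc_of_le zero_le_one] at hy
    have h1 : 0 ≤ y ^ (α - 1) := Real.rpow_nonneg hy.1.le _
    have h2 : 0 ≤ 1 - y := by linarith [hy.2]
    rw [Real.norm_of_nonneg (by positivity)]
    exact mul_le_of_le_one_right h1 (pow_le_one₀ h2 (by linarith [hy.1]))
  · rw [Set.uIoc_of_le zero_le_one] at hy
    simpa using (tendsto_pow_atTop_nhds_zero_of_lt_one (r := 1 - y) (by linarith [hy.2])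
      (by linarith [hy.1])).const_mul (y ^ (α - 1))

/-- The continuous part `y^(α-1) (1 - (1-y)^l)` of the kernel `y^(α-1)`, extended by zero. -/
noncomputable def smoothKernel (α : ℝ) (l : ℕ) (y : ℝ) : ℝ :=
  max y 0 ^ α * ∑ i ∈ range l, (1 - y) ^ i

theorem continuous_smoothKernel (hα : 0 < α) (l : ℕ) : Continuous (smoothKernel α l) := by
  have h : Continuous fun y : ℝ => max y 0 ^ α :=
    (Real.continuous_rpow_const hα.le).comp (by fun_prop)
  exact h.mul (by fun_prop)

theorem smoothKernel_of_nonpos (hα : 0 < α) (l : ℕ) {y : ℝ} (hy : y ≤ 0) :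
    smoothKernel α l y = 0 := by
  rw [smoothKernel, max_eq_right hy, Real.zero_rpow hα.ne', zero_mul]

/-- The geometric sum gives `1 - (1-y)^l = y ∑ (1-y)^i`; the extra factor `y` removes the
singularity of `y^(α-1)`. -/
theorem rpow_eq_add_smoothKernel (l : ℕ) {y : ℝ} (hy : 0 < y) :
    y ^ (α - 1) = y ^ (α - 1) * (1 - y) ^ l + smoothKernel α l y := by
  have h := geom_sum_mul_neg (1 - y) l
  rw [smoothKernel, max_eq_left hy.le]
  have h2 : y ^ α = y ^ (α - 1) * y := by
    rw [Real.rpow_sub_one hy.ne']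
    field_simp
  rw [h2]
  rw [sub_sub_cancel, mul_comm] at h
  rw [mul_assoc, h]
  ring

end Kernel

/-! ### Compactness of the fractional integral and uniform convergence. -/

section Approximation

open Finset MeasureTheory Filter Topology
open scoped Convolution

variable {α ν : ℝ}

theorem intervalIntegrable_rpow_mul_pow (hα : 0 < α) (l : ℕ) :
    IntervalIntegrable (fun y : ℝ => y ^ (α - 1) * (1 - y) ^ l) volume 0 1 :=
  (intervalIntegral.intervalIntegrable_rpow' (by linarith)).mul_continuousOn (by fun_prop)

/-- Young's inequality for the singular part of the kernel: the pointwise majorant of the squared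
convolution is integrable, with integral `‖h‖₁² ‖u‖₂²`. -/
theorem exists_integrable_majorant (hα : 0 < α) (hν : 0 < ν) (hν1 : ν ≤ 1) (l : ℕ) {u : ℝ → ℝ}
    (hu : Continuous u) :
    ∃ φ : ℝ → ℝ, Integrable φ ∧ (∀ x, 0 ≤ φ x) ∧
      ∫ x, φ x = wInner ν u u * ∫ y in (0 : ℝ)..1, y ^ (α - 1) * (1 - y) ^ l ∧
      ∀ᵐ x : ℝ, x ∈ Set.Ioc (0 : ℝ) 1 →
        (∫ s in (0 : ℝ)..x, (x - s) ^ (α - 1) * (1 - (x - s)) ^ l * u s ^ 2) * x ^ (ν - 1) ≤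
          φ x := by
  set h : ℝ → ℝ := fun y => y ^ (α - 1) * (1 - y) ^ l with hh
  set w : ℝ → ℝ := fun s => u s * u s * s ^ (ν - 1) with hw
  set H : ℝ → ℝ := (Set.Icc 0 1).indicator h with hH
  set W : ℝ → ℝ := (Set.Ioc 0 1).indicator w with hW
  have hHi : Integrable H := (integrable_indicator_iff measurableSet_Icc).2
    ((intervalIntegrable_iff_integrableOn_Icc_of_le zero_le_one).1
      (intervalIntegrable_rpow_mul_pow hα l))
  have hWi : Integrable W := (integrable_indicator_iff measurableSet_Ioc).2
    ((intervalIntegrable_iff_integrableOn_Ioc_of_le zero_le_one).1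
      (intervalIntegrable_mul_weight hν (hu.mul hu) 0 1))
  have hH0 : ∀ y, 0 ≤ H y := fun y => Set.indicator_nonneg (fun y hy =>
    mul_nonneg (Real.rpow_nonneg hy.1 _) (pow_nonneg (by linarith [hy.2]) _)) y
  have hW0 : ∀ y, 0 ≤ W y := fun y => Set.indicator_nonneg (fun y hy =>
    mul_nonneg (mul_self_nonneg _) (Real.rpow_nonneg hy.1.le _)) y
  refine ⟨W ⋆[ContinuousLinearMap.mul ℝ ℝ, volume] H, hWi.integrable_convolution _ hHi,
    fun x => ?_, ?_, ?_⟩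
  · rw [convolution_def]
    exact integral_nonneg fun s => mul_nonneg (hW0 s) (hH0 _)
  · rw [integral_convolution _ hWi hHi, ContinuousLinearMap.mul_apply', hW, hH,
      integral_indicator measurableSet_Ioc, integral_indicator measurableSet_Icc,
      integral_Icc_eq_integral_Ioc, ← intervalIntegral.integral_of_le zero_le_one,
      ← intervalIntegral.integral_of_le zero_le_one]
    rfl
  -- The convolution integral exists only for almost every `x`, hence the almost-everywhere
  -- conclusion.
  · filter_upwards [hWi.ae_convolution_exists (ContinuousLinearMap.mul ℝ ℝ) hHi] with x hx hx01
    rw [convolution_def, intervalIntegral.integral_of_le hx01.1.le,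
      ← integral_indicator measurableSet_Ioc, ← integral_mul_const]
    refine integral_mono_of_nonneg (.of_forall fun s => ?_) hx (.of_forall fun s => ?_)
    · refine mul_nonneg (Set.indicator_nonneg (fun s hs => ?_) s) (Real.rpow_nonneg hx01.1.le _)
      have h1 : 0 ≤ x - s := by linarith [hs.2]
      have h2 : 0 ≤ 1 - (x - s) := by linarith [hs.1, hx01.2]
      have := Real.rpow_nonneg h1 (α - 1)
      positivity
    · by_cases hs : s ∈ Set.Ioc 0 x
      · have h1 : 0 ≤ x - s := by linarith [hs.2]
        have h2 : 0 ≤ 1 - (x - s) := by linarith [hs.1, hx01.2]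
        -- As `ν ≤ 1` the weight decreases, so it can be moved from `x` to `s ≤ x`, inside the
        -- convolution.
        have h3 : x ^ (ν - 1) ≤ s ^ (ν - 1) :=
          Real.rpow_le_rpow_of_nonpos hs.1 hs.2 (by linarith)
        have h4 := Real.rpow_nonneg h1 (α - 1)
        have e1 : W s = w s :=
          Set.indicator_of_mem (show s ∈ Set.Ioc (0 : ℝ) 1 from ⟨hs.1, hs.2.trans hx01.2⟩) w
        have e2 : H (x - s) = h (x - s) :=
          Set.indicator_of_mem (show x - s ∈ Set.Icc (0 : ℝ) 1 from ⟨h1, by linarith [hs.1, hx01.2]⟩) h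
        simp only [Set.indicator_of_mem hs, ContinuousLinearMap.mul_apply', e1, e2, hw, hh]
        calc (x - s) ^ (α - 1) * (1 - (x - s)) ^ l * u s ^ 2 * x ^ (ν - 1)
            ≤ (x - s) ^ (α - 1) * (1 - (x - s)) ^ l * u s ^ 2 * s ^ (ν - 1) := by gcongr
          _ = _ := by ring
      · simp only [Set.indicator_of_notMem hs, zero_mul, ContinuousLinearMap.mul_apply']
        exact mul_nonneg (hW0 s) (hH0 _)

/-- Cauchy–Schwarz with the singular kernel itself as weight, whose mass on `[0, x]` is at most that
on `[0, 1]`. -/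
theorem sq_integral_singular_le (hα : 0 < α) (l : ℕ) {u : ℝ → ℝ} (hu : Continuous u) {x : ℝ}
    (hx : x ∈ Set.Ioc (0 : ℝ) 1) :
    (∫ s in (0 : ℝ)..x, (x - s) ^ (α - 1) * (1 - (x - s)) ^ l * u s) ^ 2 ≤
      (∫ y in (0 : ℝ)..1, y ^ (α - 1) * (1 - y) ^ l) *
        ∫ s in (0 : ℝ)..x, (x - s) ^ (α - 1) * (1 - (x - s)) ^ l * u s ^ 2 := by
  have hnn : ∀ y ∈ Set.Icc (0 : ℝ) 1, 0 ≤ y ^ (α - 1) * (1 - y) ^ l := fun y hy =>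
    mul_nonneg (Real.rpow_nonneg hy.1 _) (pow_nonneg (by linarith [hy.2]) _)
  have hnn' : ∀ s ∈ Set.Icc 0 x, 0 ≤ (x - s) ^ (α - 1) * (1 - (x - s)) ^ l := fun s hs =>
    hnn (x - s) ⟨by linarith [hs.2], by linarith [hs.1, hx.2]⟩
  have hint : IntervalIntegrable (fun s => (x - s) ^ (α - 1) * (1 - (x - s)) ^ l) volume 0 x :=
    intervalIntegrable_sub_rpow_mul hα (by fun_prop) x 0 x
  refine (sq_integral_mul_le hx.1.le hint hnn' hu).trans ?_
  refine mul_le_mul_of_nonneg_right ?_ (intervalIntegral.integral_nonneg hx.1.le fun s hs =>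
    mul_nonneg (hnn' s hs) (sq_nonneg _))
  rw [intervalIntegral.integral_comp_sub_left (fun y => y ^ (α - 1) * (1 - y) ^ l) x, sub_self,
    sub_zero]
  refine intervalIntegral.integral_mono_interval le_rfl hx.1.le hx.2 ?_
    (intervalIntegrable_rpow_mul_pow hα l)
  filter_upwards [ae_restrict_mem measurableSet_Ioc] with y hy
  exact hnn y ⟨hy.1.le, hy.2⟩

/-- For `ν ≤ 1` the weight is at least `1` on `(0, 1)`, so the weighted norm dominates the
unweighted one. -/
theorem sq_integral_le_of_abs_le (hν : 0 < ν) (hν1 : ν ≤ 1) {u ψ : ℝ → ℝ} (hu : Continuous u)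
    (hψ : Continuous ψ) {δ : ℝ} (h : ∀ s ∈ Set.Icc (0 : ℝ) 1, |ψ s| ≤ δ) :
    (∫ s in (0 : ℝ)..1, ψ s * u s) ^ 2 ≤ δ ^ 2 * wInner ν u u := by
  have hδ : 0 ≤ δ := (abs_nonneg _).trans (h 0 (by simp))
  have h1 := sq_integral_mul_le zero_le_one (ω := fun _ => (1 : ℝ)) (u := fun s => ψ s * u s)
    intervalIntegrable_const (fun _ _ => zero_le_one) (hψ.mul hu)
  simp only [one_mul, intervalIntegral.integral_const, sub_zero, smul_eq_mul, mul_one] at h1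
  refine h1.trans ?_
  rw [wInner, ← intervalIntegral.integral_const_mul]
  refine intervalIntegral.integral_mono_on_of_le_Ioo zero_le_one
    (((hψ.mul hu).pow 2).intervalIntegrable 0 1)
    ((intervalIntegrable_mul_weight hν (hu.mul hu) 0 1).const_mul _) fun s hs => ?_
  have hs1 : 1 ≤ s ^ (ν - 1) :=
    Real.one_le_rpow_of_pos_of_le_one_of_nonpos hs.1 hs.2.le (by linarith)
  have hs2 : ψ s ^ 2 ≤ δ ^ 2 := sq_le_sq' (neg_le_of_abs_le (h s ⟨hs.1.le, hs.2.le⟩))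
    (le_of_abs_le (h s ⟨hs.1.le, hs.2.le⟩))
  calc (ψ s * u s) ^ 2 = ψ s ^ 2 * (u s * u s) * 1 := by ring
    _ ≤ δ ^ 2 * (u s * u s) * s ^ (ν - 1) := by
      have := mul_self_nonneg (u s)
      gcongr
    _ = _ := by ring

/-- Compactness of the fractional integral: its values are approximated, uniformly on bounded sets
of the weighted space, by polynomials in `x^ν` of one fixed degree. -/
theorem exists_uniform_approx (hα : 0 < α) (hν : 0 < ν) (hν1 : ν ≤ 1) {ε : ℝ} (hε : 0 < ε) :
    ∃ m : ℕ, ∀ u F : ℝ → ℝ, Continuous u → Continuous F →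
      (∀ x ∈ Set.Ioc (0 : ℝ) 1, F x = ∫ s in (0 : ℝ)..x, (x - s) ^ (α - 1) * u s) →
      ∃ a : ℕ → ℝ,
        wInner ν (fun x => F x - ∑ i ∈ range (m + 1), a i * fracMonomial 0 ν i x)
          (fun x => F x - ∑ i ∈ range (m + 1), a i * fracMonomial 0 ν i x) ≤
        ε * wInner ν u u := by
  -- The factor `2` comes from `(p + q)² ≤ 2(p² + q²)`; the singular part contributes `δ²`, the
  -- smooth part `δ²` times the total mass `1/ν` of the weight.
  obtain ⟨δ, hδ, hδε⟩ : ∃ δ : ℝ, 0 < δ ∧ 2 * δ ^ 2 * (1 + 1 / ν) ≤ ε := by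
    refine ⟨√(ε / (2 * (1 + 1 / ν))), by positivity, ?_⟩
    rw [Real.sq_sqrt (by positivity)]
    apply le_of_eq
    field_simp
  obtain ⟨l, hl⟩ := ((tendsto_integral_rpow_mul_pow hα).eventually_lt_const hδ).exists
  set κ := ∫ y in (0 : ℝ)..1, y ^ (α - 1) * (1 - y) ^ l with hκ
  have hκ0 : 0 ≤ κ := intervalIntegral.integral_nonneg zero_le_one fun y hy =>
    mul_nonneg (Real.rpow_nonneg hy.1 _) (pow_nonneg (by linarith [hy.2]) _)
  have hg := continuous_smoothKernel hα l
  have hroot : Continuous fun t : ℝ => t ^ (1 / ν) := Real.continuous_rpow_const (by positivity)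
  -- In the variable `t = x^ν`, polynomials in `t` are combinations of the `x^(iν)`.
  have hG : Continuous (Function.uncurry fun t s : ℝ => smoothKernel α l (t ^ (1 / ν) - s)) :=
    hg.comp ((hroot.comp continuous_fst).sub continuous_snd)
  obtain ⟨m, b, z, hb, hG'⟩ := exists_polynomial_kernel hG hδ
  refine ⟨m, fun u F hu hF hFu => ?_⟩
  set W := wInner ν u u with hW
  have hW0 : 0 ≤ W := wInner_self_nonneg u
  set q : Fin (m + 1) → ℝ := fun k =>
    ∫ s in (0 : ℝ)..1, smoothKernel α l (z k ^ (1 / ν) - s) * u s with hq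
  refine ⟨fun i => ∑ k, q k * (b k).coeff i, ?_⟩
  set v : ℝ → ℝ := fun x => ∑ i ∈ range (m + 1), (∑ k, q k * (b k).coeff i) * fracMonomial 0 ν i x
    with hv
  have hvc : Continuous v :=
    continuous_finsetSum _ fun i _ => (continuous_rpow_natMul_add hν le_rfl i).const_mul _
  have hFv : Continuous fun x => F x - v x := hF.sub hvc
  have hgs : ∀ c : ℝ, Continuous fun s => smoothKernel α l (c - s) := fun c =>
    hg.comp (by fun_prop)
  have hvx : ∀ x ∈ Set.Ioc (0 : ℝ) 1, v x = ∑ k, (b k).eval (x ^ ν) * q k := by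
    intro x hx
    simp only [hv, sum_mul]
    rw [sum_comm]
    refine sum_congr rfl fun k _ => ?_
    rw [Polynomial.eval_eq_sum_range' (Nat.lt_succ_of_le (hb k)), sum_mul]
    refine sum_congr rfl fun i _ => ?_
    rw [fracMonomial, add_zero, mul_comm (i : ℝ), Real.rpow_mul hx.1.le, Real.rpow_natCast]
    ring
  obtain ⟨φ, hφi, hφ0, hφint, hφ⟩ := exists_integrable_majorant hα hν hν1 l hu
  have hpt : ∀ x ∈ Set.Ioc (0 : ℝ) 1, (F x - v x) * (F x - v x) ≤
      2 * (κ * ∫ s in (0 : ℝ)..x, (x - s) ^ (α - 1) * (1 - (x - s)) ^ l * u s ^ 2) +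
        2 * (δ ^ 2 * W) := by
    intro x hx
    have hxν : (x ^ ν) ^ (1 / ν) = x := by
      rw [one_div, Real.rpow_rpow_inv hx.1.le hν.ne']
    have i1 : IntervalIntegrable (fun s => (x - s) ^ (α - 1) * (1 - (x - s)) ^ l * u s)
        volume 0 x := by
      have := intervalIntegrable_sub_rpow_mul hα (u := fun s => (1 - (x - s)) ^ l * u s)
        (by fun_prop) x 0 x
      simpa only [mul_assoc] using this
    have i2 : ∀ c p r : ℝ, IntervalIntegrable (fun s => smoothKernel α l (c - s) * u s)
        volume p r := fun c p r => ((hgs c).mul hu).intervalIntegrable p r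
    have e1 : F x = (∫ s in (0 : ℝ)..x, (x - s) ^ (α - 1) * (1 - (x - s)) ^ l * u s) +
        ∫ s in (0 : ℝ)..1, smoothKernel α l (x - s) * u s := by
      -- The smooth kernel vanishes for `s ≥ x`, so its integral can run over the fixed interval
      -- `[0, 1]`.
      have e0 : ∫ s in x..1, smoothKernel α l (x - s) * u s = 0 := by
        rw [intervalIntegral.integral_congr (g := fun _ => (0 : ℝ)), intervalIntegral.integral_zero]
        intro s hs
        rw [Set.uIcc_of_le hx.2] at hs
        simp only
        rw [smoothKernel_of_nonpos hα l (by linarith [hs.1]), zero_mul]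
      rw [← intervalIntegral.integral_add_adjacent_intervals (i2 x 0 x) (i2 x x 1), e0, add_zero,
        ← intervalIntegral.integral_add i1 (i2 x 0 x), hFu x hx,
        intervalIntegral.integral_of_le hx.1.le, intervalIntegral.integral_of_le hx.1.le,
        integral_Ioc_eq_integral_Ioo, integral_Ioc_eq_integral_Ioo]
      refine setIntegral_congr_fun measurableSet_Ioo fun s hs => ?_
      rw [← add_mul, ← rpow_eq_add_smoothKernel l (sub_pos.2 hs.2)]
    have e2 : F x - v x = (∫ s in (0 : ℝ)..x, (x - s) ^ (α - 1) * (1 - (x - s)) ^ l * u s) +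
        ∫ s in (0 : ℝ)..1, (smoothKernel α l (x - s) -
          ∑ k, (b k).eval (x ^ ν) * smoothKernel α l (z k ^ (1 / ν) - s)) * u s := by
      have e3 : v x = ∫ s in (0 : ℝ)..1,
          ∑ k, (b k).eval (x ^ ν) * (smoothKernel α l (z k ^ (1 / ν) - s) * u s) := by
        rw [hvx x hx, intervalIntegral.integral_finsetSum
          fun k _ => (i2 (z k ^ (1 / ν)) 0 1).const_mul _]
        simp only [intervalIntegral.integral_const_mul, hq]
      rw [e1, e3, add_sub_assoc, ← intervalIntegral.integral_sub (i2 x 0 1)]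
      · simp only [sub_mul, sum_mul, mul_assoc]
      · exact (continuous_finsetSum _ fun k _ =>
          ((hgs _).mul hu).const_mul _).intervalIntegrable 0 1
    have b1 := sq_integral_singular_le hα l hu hx
    have b2 := sq_integral_le_of_abs_le hν hν1 hu
      (ψ := fun s => smoothKernel α l (x - s) -
        ∑ k, (b k).eval (x ^ ν) * smoothKernel α l (z k ^ (1 / ν) - s))
      ((hgs x).sub (continuous_finsetSum _ fun k _ => (hgs _).const_mul _)) (δ := δ)
      (fun s hs => by
        have := hG' (x ^ ν) ⟨Real.rpow_nonneg hx.1.le _,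
          Real.rpow_le_one hx.1.le hx.2 hν.le⟩ s hs
        simpa only [hxν] using this)
    rw [e2]
    refine le_trans ?_ (add_le_add (mul_le_mul_of_nonneg_left b1 zero_le_two)
      (mul_le_mul_of_nonneg_left b2 zero_le_two))
    rw [← mul_add, ← sq]
    exact add_sq_le
  have hwt : ∫ x in (0 : ℝ)..1, x ^ (ν - 1) = 1 / ν := by
    rw [integral_rpow (Or.inl (by linarith)), sub_add_cancel, Real.one_rpow,
      Real.zero_rpow hν.ne', sub_zero]
  have hwi : IntervalIntegrable (fun x : ℝ => x ^ (ν - 1)) volume 0 1 :=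
    intervalIntegral.intervalIntegrable_rpow' (by linarith)
  have hφI : IntervalIntegrable φ volume 0 1 := hφi.intervalIntegrable
  have hφle : ∫ x in (0 : ℝ)..1, φ x ≤ W * κ := by
    rw [← hφint, intervalIntegral.integral_of_le zero_le_one]
    exact setIntegral_le_integral hφi (.of_forall hφ0)
  calc wInner ν (fun x => F x - v x) (fun x => F x - v x)
      ≤ ∫ x in (0 : ℝ)..1, (2 * κ * φ x + 2 * (δ ^ 2 * W) * x ^ (ν - 1)) := by
        rw [wInner]
        refine intervalIntegral.integral_mono_ae_restrict zero_le_one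
          (intervalIntegrable_mul_weight hν (hFv.mul hFv) 0 1)
          ((hφI.const_mul _).add (hwi.const_mul _)) ?_
        rw [← Measure.restrict_congr_set Ioc_ae_eq_Icc]
        filter_upwards [ae_restrict_mem measurableSet_Ioc, ae_restrict_of_ae hφ] with x hx hφx
        have hx0 := Real.rpow_nonneg hx.1.le (ν - 1)
        refine (mul_le_mul_of_nonneg_right (hpt x hx) hx0).trans ?_
        have := mul_le_mul_of_nonneg_left (hφx hx) (mul_nonneg zero_le_two hκ0)
        linarith
    _ = 2 * κ * (∫ x in (0 : ℝ)..1, φ x) + 2 * (δ ^ 2 * W) * (1 / ν) := by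
        rw [intervalIntegral.integral_add (hφI.const_mul _) (hwi.const_mul _),
          intervalIntegral.integral_const_mul, intervalIntegral.integral_const_mul, hwt]
    _ ≤ 2 * δ * (W * δ) + 2 * (δ ^ 2 * W) * (1 / ν) := by
        have : (∫ x in (0 : ℝ)..1, φ x) ≤ W * δ :=
          hφle.trans (mul_le_mul_of_nonneg_left hl.le hW0)
        have h0 : 0 ≤ W * δ := by positivity
        gcongr ?_ + _
        refine (mul_le_mul_of_nonneg_left this (by positivity)).trans ?_
        gcongr
    _ = 2 * δ ^ 2 * (1 + 1 / ν) * W := by ring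
    _ ≤ ε * W := by gcongr

theorem exists_forall_wNorm_errorVec_lt (hα : 0 < α) (hν : 0 < ν) (hν1 : ν ≤ 1) {ε : ℝ}
    (hε : 0 < ε) :
    ∃ N₀ : ℕ, ∀ N : ℕ, N₀ ≤ N → ∀ n : Fin (N + 1), wNorm ν (errorVec α ν N n) < ε := by
  -- Since `‖C_{N,n}‖² ≤ 1/ν`, the factor `ε²ν/2` yields `‖e_n‖² ≤ ε²/2`.
  obtain ⟨m, hm⟩ := exists_uniform_approx hα hν hν1 (ε := ε ^ 2 * ν / 2) (by positivity)
  refine ⟨m, fun N hN n => ?_⟩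
  obtain ⟨a, ha⟩ := hm (chelyshkov ν N n) (fracIntegral α ν N n) (continuous_chelyshkov hν N n)
    (continuous_fracIntegral hα hν N n) fun x hx => fracIntegral_eq hα hν N n hx.1
  have h1 := (wInner_errorSum_le hα hν N n a hN).trans ha
  rw [wInner_chelyshkov_self hν (by omega)] at h1
  rw [wNorm_congr (errorVec_eq_errorSum hα hν N n)]
  refine lt_of_pow_lt_pow_left₀ 2 hε.le ?_
  rw [wNorm_sq]
  refine h1.trans_lt ?_
  have hn : (1 : ℝ) ≤ 2 * ((n : ℕ) : ℝ) + 1 := by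
    have : (0 : ℝ) ≤ ((n : ℕ) : ℝ) := Nat.cast_nonneg _
    linarith
  have h2 : (ν * (2 * ((n : ℕ) : ℝ) + 1))⁻¹ ≤ ν⁻¹ :=
    inv_anti₀ hν (le_mul_of_one_le_right hν.le hn)
  calc ε ^ 2 * ν / 2 * (ν * (2 * ((n : ℕ) : ℝ) + 1))⁻¹ ≤ ε ^ 2 * ν / 2 * ν⁻¹ := by gcongr
    _ = ε ^ 2 / 2 := by field_simp
    _ < ε ^ 2 := half_lt_self (by positivity)

end Approximation

end FracChelyshkov

theorem mainTheorem5 (α ν : ℝ) (hα : 0 < α) (hν : 0 < ν) (hν1 : ν ≤ 1) :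
    (∀ (N : ℕ) (n : Fin (N + 1)),
      FracChelyshkov.MemWL2 ν (FracChelyshkov.errorVec α ν N n)) ∧
    (∀ N : ℕ, 0 < FracChelyshkov.gramDet ν
      (fun k : Fin (N + 1) => FracChelyshkov.chelyshkov ν N k)) ∧
    (∀ N j : ℕ, j ≤ N →
      FracChelyshkov.wNorm ν (FracChelyshkov.monomialError α ν N j) ^ 2 =
        FracChelyshkov.gramRatio ν N (FracChelyshkov.fracMonomial α ν j)) ∧
    (∀ (N : ℕ) (n : Fin (N + 1)),
      FracChelyshkov.wNorm ν (FracChelyshkov.errorVec α ν N n) ≤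
        ∑ j ∈ Finset.Icc (n : ℕ) N,
          ((N - (n : ℕ)).choose (j - (n : ℕ)) : ℝ) * ((N + j + 1).choose (N - (n : ℕ)) : ℝ) *
            ProbabilityTheory.beta α ((j : ℝ) * ν + 1) *
            Real.sqrt (FracChelyshkov.gramRatio ν N (FracChelyshkov.fracMonomial α ν j))) ∧
    (∀ ε : ℝ, 0 < ε → ∃ N₀ : ℕ, ∀ N : ℕ, N₀ ≤ N → ∀ n : Fin (N + 1),
      FracChelyshkov.wNorm ν (FracChelyshkov.errorVec α ν N n) < ε) := by
  exact ⟨fun N n => FracChelyshkov.memWL2_of_eqOn hν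
      (FracChelyshkov.continuous_errorSum hα hν N n) (FracChelyshkov.errorVec_eq_errorSum hα hν N n),
    FracChelyshkov.gramDet_chelyshkov_pos hν,
    fun N j _ => FracChelyshkov.wNorm_monomialError_sq hα hν N j,
    FracChelyshkov.wNorm_errorVec_le hα hν,
    fun ε hε => FracChelyshkov.exists_forall_wNorm_errorVec_lt hα hν hν1 hε⟩
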